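/- For every real $\varepsilon>0$ there is a constant $C>0$, depending only on $\varepsilon$, such that for all $M\in\mathbb{Z}$, $N\in\mathbb{N}$, real $Q\ge 1$ and all sequences of complex numbers $(a_n)_{n\in\mathbb{Z}}$, $$\sum_{1\le q\le Q}\ \sum_{\substack{a=1\\ (a,q)=1}}^{q^2}\left|S\left(\frac{a}{q^2}\right)\right|^2\ \le\ C\,(NQ)^{\varepsilon}\left(Q^3+N+\sqrt{N}\,Q^2\right)Z,$$ where $$S(\alpha)=\sum_{n=M+1}^{M+N}a_n e(n\alpha),\qquad Z=\sum_{n=M+1}^{M+N}|a_n|^2,\qquad e(x)=e^{2\pi i x}.$$ -/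

import Mathlib

noncomputable section

namespace SquareModuliSieve

/-- The additive character `e(x) = exp(2πix)`. -/
def e (x : ℝ) : ℂ := Complex.exp (2 * Real.pi * Complex.I * x)

/-- The trigonometric polynomial `S(α) = ∑_{n=M+1}^{M+N} a_n e(nα)`. -/
def S (M : ℤ) (N : ℕ) (a : ℤ → ℂ) (α : ℝ) : ℂ :=
  ∑ n ∈ Finset.Icc (M + 1) (M + N), a n * e (n * α)

/-- The squared norm `Z = ∑_{n=M+1}^{M+N} |a_n|²` of the coefficients. -/
def Z (M : ℤ) (N : ℕ) (a : ℤ → ℂ) : ℝ :=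
  ∑ n ∈ Finset.Icc (M + 1) (M + N), ‖a n‖ ^ 2

end SquareModuliSieve

end

/-! The large sieve in local form (`sum_norm_S_sq_le`, by duality and a Fejér kernel) bounds the sum
of |S|² over any finite set of points by a constant times K N Z, where K bounds the number of points
in an arc of radius Δ = 1/N. It remains to show K ≪ N^ε (1 + Q³/N + Q²/√N) for the fractions a/q².

Near a given α, Dirichlet gives α = b/r + z with r ≤ √N. Put m = a r − b q². Then |m| ≤ B = rQ²(|z|
+ Δ) ≪ Q²/√N. For fixed m, the q lie in a set of diameter at most L = 6QΔ/(|z| + Δ) and solve b q² +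
m ≡ 0 (mod r), so there are ≪ τ(r)(1 + L gcd(m,r)/r) of them (`Int.card_le_of_dvd_mul_sq_add`). As
gcd(m,r) is at most τ(r) on average, the m ≠ 0 contribute ≪ τ(r)B + τ(r)²LB/r, and LB = 6rQ³Δ is
free of z. The value m = 0 contributes at most one fraction, and the divisor bound absorbs τ(r). -/

/-! ### The divisor bound -/

open Finset in
/-- The divisor bound `τ(n) ≪ n ^ δ`. -/
theorem Nat.exists_card_divisors_le_mul_rpow {δ : ℝ} (hδ : 0 < δ) :
    ∃ C : ℝ, 1 ≤ C ∧ ∀ n : ℕ, n ≠ 0 → (#n.divisors : ℝ) ≤ C * (n : ℝ) ^ δ := by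
  -- For p ≥ B one has p^δ ≥ 2, so k + 1 ≤ 2^k ≤ p^(kδ) costs no constant. Each of the at most B
  -- smaller primes costs a factor A, by Bernoulli.
  set B : ℕ := ⌈(2 : ℝ) ^ (1 / δ)⌉₊ with hB
  have hl : 0 < δ * Real.log 2 := mul_pos hδ (Real.log_pos (by norm_num))
  set A : ℝ := 1 + 1 / (δ * Real.log 2) with hA
  have hA1 : 1 ≤ A := by
    have : 0 < 1 / (δ * Real.log 2) := by positivity
    linarith
  have key : ∀ p k : ℕ, p.Prime →
      ((k : ℝ) + 1) ≤ (if p < B then A else 1) * ((p : ℝ) ^ k) ^ δ := by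
    intro p k hp
    have hp2 : (2 : ℝ) ≤ p := by exact_mod_cast hp.two_le
    have hswap : ((p : ℝ) ^ k) ^ δ = ((p : ℝ) ^ δ) ^ k := by
      rw [← Real.rpow_natCast, ← Real.rpow_natCast, ← Real.rpow_mul (by positivity),
        ← Real.rpow_mul (by positivity), mul_comm]
    rw [hswap]
    split_ifs with h
    · have h1 : 1 + δ * Real.log 2 ≤ (p : ℝ) ^ δ := by
        have h2 : (2 : ℝ) ^ δ ≤ (p : ℝ) ^ δ := Real.rpow_le_rpow (by norm_num) hp2 hδ.le
        have h3 := Real.add_one_le_exp (Real.log 2 * δ)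
        rw [← Real.rpow_def_of_pos (by norm_num)] at h3
        linarith
      have h4 : 1 + (k : ℝ) * (δ * Real.log 2) ≤ ((p : ℝ) ^ δ) ^ k :=
        (one_add_mul_le_pow (by linarith) k).trans (pow_le_pow_left₀ (by linarith) h1 k)
      have h5 : (k : ℝ) + 1 ≤ A * (1 + (k : ℝ) * (δ * Real.log 2)) := by
        have : A * (1 + (k : ℝ) * (δ * Real.log 2)) =
            1 + k + (k * (δ * Real.log 2) + 1 / (δ * Real.log 2)) := by
          rw [hA]; field_simp; ring
        rw [this]
        have : 0 ≤ (k : ℝ) * (δ * Real.log 2) + 1 / (δ * Real.log 2) := by positivity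
        linarith
      exact h5.trans (mul_le_mul_of_nonneg_left h4 (by linarith))
    · have h1 : (2 : ℝ) ≤ (p : ℝ) ^ δ := by
        have h2 : (2 : ℝ) ^ (1 / δ) ≤ p := (Nat.le_ceil _).trans (by exact_mod_cast not_lt.mp h)
        have h3 := Real.rpow_le_rpow (by positivity) h2 hδ.le
        rwa [← Real.rpow_mul (by norm_num), one_div_mul_cancel hδ.ne', Real.rpow_one] at h3
      rw [one_mul]
      have h4 : 1 + (k : ℝ) * 1 ≤ (1 + 1) ^ k := one_add_mul_le_pow (by norm_num) k
      have h5 := pow_le_pow_left₀ (by norm_num) h1 k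
      norm_num at h4
      linarith
  refine ⟨A ^ B, one_le_pow₀ hA1, fun n hn => ?_⟩
  rw [Nat.card_divisors hn]
  push_cast
  refine (prod_le_prod (fun _ _ => by positivity)
    (fun p hp => key p (n.factorization p) (Nat.prime_of_mem_primeFactors hp))).trans ?_
  rw [prod_mul_distrib, Real.finsetProd_rpow _ _ (fun _ _ => by positivity)]
  have h1 : ∏ p ∈ n.primeFactors, (p : ℝ) ^ n.factorization p = n := by
    have := Nat.prod_factorization_pow_eq_self hn
    rw [Nat.prod_factorization_eq_prod_primeFactors] at this
    exact_mod_cast this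
  rw [h1]
  refine mul_le_mul_of_nonneg_right ?_ (by positivity)
  rw [prod_ite, prod_const, prod_const_one, mul_one]
  refine pow_le_pow_right₀ hA1 ?_
  calc #{p ∈ n.primeFactors | p < B} ≤ #(range B) :=
        card_le_card fun p hp => by simp at hp ⊢; exact hp.2
    _ = B := card_range B

/-! ### Quadratic congruences in short intervals, and gcd sums -/

open Finset in
/-- A set of integers of diameter at most `L` in one residue class modulo `k`
has at most `1 + L / k` elements. -/
theorem Int.card_le_one_add_div_of_modEq {s : Finset ℤ} {k : ℕ} {L : ℝ} (hk : 0 < k) (hL : 0 ≤ L)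
    (hmod : ∀ x ∈ s, ∀ y ∈ s, (k : ℤ) ∣ x - y)
    (hdiam : ∀ x ∈ s, ∀ y ∈ s, (x : ℝ) - y ≤ L) : (#s : ℝ) ≤ 1 + L / k := by
  have hk' : (0 : ℝ) < k := by exact_mod_cast hk
  rcases s.eq_empty_or_nonempty with rfl | hs
  · simp; positivity
  set x₀ := s.min' hs
  have hx₀ : x₀ ∈ s := s.min'_mem hs
  have hle : #s ≤ #(Finset.range (⌊L / k⌋₊ + 1)) := by
    refine card_le_card_of_injOn (fun x => ((x - x₀) / k).toNat) (fun x hx => ?_) ?_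
    · obtain ⟨t, ht⟩ := hmod x hx x₀ hx₀
      have h0 : 0 ≤ x - x₀ := sub_nonneg.mpr (s.min'_le x hx)
      have ht0 : 0 ≤ t := by
        rw [ht] at h0; exact nonneg_of_mul_nonneg_right h0 (by exact_mod_cast hk)
      have h2 := hdiam x hx x₀ hx₀
      have h3 : (k : ℝ) * t ≤ L := by rw [← Int.cast_sub, ht] at h2; exact_mod_cast h2
      simp only [coe_range, Set.mem_Iio]
      rw [ht, Int.mul_ediv_cancel_left _ (by exact_mod_cast hk.ne'), Nat.lt_succ_iff]
      refine Nat.le_floor ?_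
      rw [le_div_iff₀ hk', mul_comm]
      have : ((t.toNat : ℕ) : ℝ) = (t : ℝ) := by exact_mod_cast Int.toNat_of_nonneg ht0
      rwa [this]
    · intro x hx y hy hxy
      obtain ⟨t, ht⟩ := hmod x hx x₀ hx₀
      obtain ⟨u, hu⟩ := hmod y hy x₀ hx₀
      have hkz : (0 : ℤ) < k := by exact_mod_cast hk
      have ht0 : 0 ≤ t := nonneg_of_mul_nonneg_right (ht ▸ sub_nonneg.mpr (s.min'_le x hx)) hkz
      have hu0 : 0 ≤ u := nonneg_of_mul_nonneg_right (hu ▸ sub_nonneg.mpr (s.min'_le y hy)) hkz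
      simp only at hxy
      rw [ht, hu, Int.mul_ediv_cancel_left _ hkz.ne', Int.mul_ediv_cancel_left _ hkz.ne'] at hxy
      have : t = u := by omega
      subst this
      linarith
  rw [card_range] at hle
  calc (#s : ℝ) ≤ (⌊L / k⌋₊ + 1 : ℕ) := by exact_mod_cast hle
    _ ≤ 1 + L / k := by
      push_cast
      have := Nat.floor_le (div_nonneg hL hk'.le)
      linarith

open Finset in
/-- The number of solutions of `b q² + m ≡ 0 (mod r)` in a set of diameter at most `L`. -/
theorem Int.card_le_of_dvd_mul_sq_add {s : Finset ℤ} {r : ℕ} {b m : ℤ} {L : ℝ} (hr : 0 < r)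
    (hL : 0 ≤ L) (hb : IsCoprime (r : ℤ) b) (hs : ∀ q ∈ s, (r : ℤ) ∣ b * q ^ 2 + m)
    (hdiam : ∀ x ∈ s, ∀ y ∈ s, (x : ℝ) - y ≤ L) :
    (#s : ℝ) ≤ #r.divisors * (1 + 2 * L * (m.gcd r : ℕ) / r) := by
  have hr' : (0 : ℝ) < r := by exact_mod_cast hr
  rcases s.eq_empty_or_nonempty with rfl | ⟨q₀, hq₀⟩
  · simp; positivity
  -- Solutions are sorted by d = gcd(q − q₀, r), with q₀ a fixed solution. Writing r = d f, the
  -- relation r ∣ b(q − q₀)(q + q₀) forces d ∣ q − q₀ and f ∣ q + q₀, hence a single class modulo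
  -- lcm(d, f).
  have hmaps : Set.MapsTo (fun q : ℤ => (q - q₀).gcd r) s r.divisors := fun q _ => by
    simp only [mem_coe, Nat.mem_divisors]
    exact ⟨by exact_mod_cast Int.gcd_dvd_right (q - q₀) (r : ℤ), hr.ne'⟩
  rw [card_eq_sum_card_fiberwise hmaps]
  push_cast
  rw [← nsmul_eq_mul]
  refine sum_le_card_nsmul _ _ _ fun d hd => ?_
  have hdr : d ∣ r := Nat.dvd_of_mem_divisors hd
  obtain ⟨f, hf⟩ := hdr
  have hd0 : 0 < d := Nat.pos_of_mem_divisors hd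
  have hf0 : 0 < f := Nat.pos_of_ne_zero fun h => by simp [h] at hf; omega
  rcases ({q ∈ s | (q - q₀).gcd r = d}).eq_empty_or_nonempty with he | ⟨q₁, hq₁⟩
  · rw [he]; simp; positivity
  have hprop : ∀ q ∈ s, (q - q₀).gcd r = d → (d : ℤ) ∣ q - q₀ ∧ (f : ℤ) ∣ q + q₀ := by
    intro q hq hqd
    have hd1 : (d : ℤ) ∣ q - q₀ := hqd ▸ Int.gcd_dvd_left (q - q₀) (r : ℤ)
    refine ⟨hd1, ?_⟩
    have h1 : (r : ℤ) ∣ b * ((q - q₀) * (q + q₀)) := by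
      have := Int.dvd_sub (hs q hq) (hs q₀ hq₀)
      convert this using 1; ring
    have h2 : (r : ℤ) ∣ (q - q₀) * (q + q₀) := hb.dvd_of_dvd_mul_left h1
    obtain ⟨t, ht⟩ := hd1
    have hdz : (d : ℤ) ≠ 0 := by exact_mod_cast hd0.ne'
    have h3 : (f : ℤ) ∣ t * (q + q₀) := by
      rw [ht, hf] at h2
      push_cast at h2
      rw [mul_assoc] at h2
      exact (mul_dvd_mul_iff_left hdz).mp h2
    refine IsCoprime.dvd_of_dvd_mul_left ?_ h3
    rw [Int.isCoprime_iff_gcd_eq_one, Int.gcd_comm]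
    have h4 : ((d : ℤ) * t).gcd ((d : ℤ) * f) = d := by
      rw [← ht]; convert hqd using 2; rw [hf]; push_cast; rfl
    rw [Int.gcd_mul_left] at h4
    simp only [Int.natAbs_natCast] at h4
    exact Nat.eq_of_mul_eq_mul_left hd0 (by rw [h4, mul_one])
  set h := d.gcd f with hh
  set k := d.lcm f with hk
  have hk0 : 0 < k := Nat.lcm_pos hd0 hf0
  have hhk : h * k = r := by rw [hf]; exact Nat.gcd_mul_lcm d f
  have hh0 : 0 < h := Nat.gcd_pos_of_pos_left _ hd0
  -- The loss h = r / lcm(d, f) is controlled by m: h ∣ 2q₀ and h² ∣ r give h² ∣ 4m, so h² ≤ 4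
  -- gcd(m, r).
  have hhg : h ≤ 2 * m.gcd r := by
    obtain ⟨hq₁s, hq₁d⟩ := mem_filter.mp hq₁
    obtain ⟨u1, u2⟩ := hprop q₁ hq₁s hq₁d
    have hhd : (h : ℤ) ∣ d := by exact_mod_cast Nat.gcd_dvd_left d f
    have hhf : (h : ℤ) ∣ f := by exact_mod_cast Nat.gcd_dvd_right d f
    have v1 : (h : ℤ) ∣ 2 * q₀ := by
      have := Int.dvd_sub (hhf.trans u2) (hhd.trans u1)
      convert this using 1; ring
    have v2 : (h : ℤ) ^ 2 ∣ r := by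
      rw [hf, sq]; push_cast; exact mul_dvd_mul hhd hhf
    have v3 : (h : ℤ) ^ 2 ∣ 4 * m := by
      have w1 : (h : ℤ) ^ 2 ∣ (2 * q₀) ^ 2 := pow_dvd_pow_of_dvd v1 2
      have w2 := Int.dvd_sub ((v2.trans (hs q₀ hq₀)).mul_left 4) (w1.mul_left b)
      convert w2 using 1; ring
    have v4 : h ^ 2 ∣ 4 * m.gcd r := by
      have := Int.dvd_coe_gcd v3 (v2.mul_left 4)
      rw [Int.gcd_mul_left] at this
      exact_mod_cast this
    have hg : 0 < m.gcd r := Int.gcd_pos_of_ne_zero_right _ (by exact_mod_cast hr.ne')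
    have v5 := Nat.le_of_dvd (by positivity) v4
    nlinarith
  have hcard : (#{q ∈ s | (q - q₀).gcd r = d} : ℝ) ≤ 1 + L / k := by
    refine Int.card_le_one_add_div_of_modEq hk0 hL (fun x hx y hy => ?_)
      fun x hx y hy => hdiam x (mem_filter.mp hx).1 y (mem_filter.mp hy).1
    obtain ⟨x1, x2⟩ := hprop x (mem_filter.mp hx).1 (mem_filter.mp hx).2
    obtain ⟨y1, y2⟩ := hprop y (mem_filter.mp hy).1 (mem_filter.mp hy).2
    have z1 : (d : ℤ) ∣ x - y := by convert Int.dvd_sub x1 y1 using 1; ring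
    have z2 : (f : ℤ) ∣ x - y := by convert Int.dvd_sub x2 y2 using 1; ring
    rw [Int.natCast_dvd] at z1 z2 ⊢
    exact Nat.lcm_dvd z1 z2
  refine hcard.trans ?_
  have hk' : (0 : ℝ) < k := by exact_mod_cast hk0
  have e1 : (r : ℝ) = h * k := by exact_mod_cast hhk.symm
  have e2 : (h : ℝ) ≤ 2 * (m.gcd r : ℕ) := by exact_mod_cast hhg
  have : L / k ≤ 2 * L * (m.gcd r : ℕ) / r := by
    rw [div_le_div_iff₀ hk' hr', e1]
    have := mul_le_mul_of_nonneg_left e2 (mul_nonneg hL hk'.le)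
    linarith
  linarith

open Finset in
theorem Nat.sum_gcd_le_mul_card_divisors (M : ℕ) {r : ℕ} (hr : 0 < r) :
    ∑ n ∈ Ioc 0 M, n.gcd r ≤ M * #r.divisors := by
  calc ∑ n ∈ Ioc 0 M, n.gcd r ≤ ∑ n ∈ Ioc 0 M, ∑ d ∈ r.divisors, if d ∣ n then d else 0 := by
        refine sum_le_sum fun n _ => ?_
        have h := single_le_sum (f := fun d => if d ∣ n then d else 0) (fun _ _ => Nat.zero_le _)
          (Nat.mem_divisors.mpr ⟨Nat.gcd_dvd_right n r, hr.ne'⟩)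
        simpa [Nat.gcd_dvd_left] using h
    _ = ∑ d ∈ r.divisors, M / d * d := by
        rw [sum_comm]
        refine sum_congr rfl fun d _ => ?_
        rw [← sum_filter, sum_const, Nat.Ioc_filter_dvd_card_eq_div, smul_eq_mul]
    _ ≤ ∑ d ∈ r.divisors, M := sum_le_sum fun d _ => Nat.div_mul_le_self M d
    _ = M * #r.divisors := by rw [sum_const, smul_eq_mul, mul_comm]

/-! ### The additive character and geometric sums -/

namespace SquareModuliSieve

theorem e_add (x y : ℝ) : e (x + y) = e x * e y := by
  simp only [e, ← Complex.exp_add]; congr 1; push_cast; ring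

theorem e_eq_exp_ofReal_mul_I (x : ℝ) : e x = Complex.exp ((2 * Real.pi * x : ℝ) * Complex.I) := by
  simp only [e]; congr 1; push_cast; ring

theorem norm_e (x : ℝ) : ‖e x‖ = 1 := by
  rw [e_eq_exp_ofReal_mul_I, Complex.norm_exp_ofReal_mul_I]

theorem conj_e (x : ℝ) : (starRingEnd ℂ) (e x) = e (-x) := by
  rw [e_eq_exp_ofReal_mul_I, e_eq_exp_ofReal_mul_I, ← Complex.exp_conj, map_mul,
    Complex.conj_ofReal, Complex.conj_I]
  congr 1; push_cast; ring

theorem e_int (k : ℤ) : e k = 1 := by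
  have := Complex.exp_int_mul_two_pi_mul_I k
  rw [← this, e]; congr 1; push_cast; ring

theorem e_natCast_mul (h : ℕ) (x : ℝ) : e (h * x) = e x ^ h := by
  rw [e, e, ← Complex.exp_nat_mul]; congr 1; push_cast; ring

/-- The geometric sum `∑_{h < H} e(hβ)`. -/
noncomputable def geomExp (H : ℕ) (β : ℝ) : ℂ := ∑ h ∈ Finset.range H, e (h * β)

theorem norm_geomExp_le (H : ℕ) (β : ℝ) : ‖geomExp H β‖ ≤ H := by
  refine (norm_sum_le _ _).trans ?_
  simp [norm_e]

theorem conj_geomExp (H : ℕ) (β : ℝ) : (starRingEnd ℂ) (geomExp H β) = geomExp H (-β) := by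
  simp only [geomExp, map_sum, conj_e, mul_neg]

theorem norm_geomExp_neg (H : ℕ) (β : ℝ) : ‖geomExp H (-β)‖ = ‖geomExp H β‖ := by
  rw [← conj_geomExp, Complex.norm_conj]

/-- Here |e(x) − 1| = 2|sin πx|, and Jordan's inequality applies. -/
theorem four_mul_abs_le_norm_e_sub_one {x : ℝ} (hx : |x| ≤ 1 / 2) : 4 * |x| ≤ ‖e x - 1‖ := by
  have h1 : ‖e x - 1‖ = 2 * |Real.sin (Real.pi * x)| := by
    rw [e_eq_exp_ofReal_mul_I, mul_comm, Complex.norm_exp_I_mul_ofReal_sub_one, Real.norm_eq_abs,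
      abs_mul, abs_two]
    congr 3; ring
  have h2 : |Real.sin (Real.pi * x)| = Real.sin (Real.pi * |x|) := by
    rcases le_total 0 x with h | h
    · rw [abs_of_nonneg h, abs_of_nonneg]
      rw [abs_of_nonneg h] at hx
      exact Real.sin_nonneg_of_nonneg_of_le_pi (by positivity) (by nlinarith [Real.pi_pos])
    · rw [abs_of_nonpos h] at hx ⊢
      rw [mul_neg, Real.sin_neg, abs_of_nonpos]
      exact Real.sin_nonpos_of_nonpos_of_neg_pi_le (by nlinarith [Real.pi_pos])
        (by nlinarith [Real.pi_pos])
  have h3 := Real.mul_le_sin (x := Real.pi * |x|) (by positivity) (by nlinarith [Real.pi_pos])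
  have h4 : 2 / Real.pi * (Real.pi * |x|) = 2 * |x| := by field_simp
  rw [h1, h2]; linarith

theorem norm_geomExp_mul_abs_le (H : ℕ) (β : ℝ) : ‖geomExp H β‖ * |β - round β| ≤ 1 / 2 := by
  have h1 : geomExp H β * (e β - 1) = e (H * β) - 1 := by
    simp only [geomExp, e_natCast_mul]
    exact geom_sum_mul _ _
  have h2 : e β = e (β - round β) := by
    conv_lhs => rw [← sub_add_cancel β (round β : ℝ), e_add, e_int, mul_one]
  have h3 := four_mul_abs_le_norm_e_sub_one (abs_sub_round β)
  rw [← h2] at h3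
  have h4 : ‖geomExp H β‖ * ‖e β - 1‖ ≤ 2 := by
    rw [← norm_mul, h1]
    refine (norm_sub_le _ _).trans ?_
    rw [norm_e, norm_one]; norm_num
  have := mul_le_mul_of_nonneg_left h3 (norm_nonneg (geomExp H β))
  linarith

/-- Merges the trivial bound 2N with the decay 1/(2‖β‖) into a weight that is summable over
consecutive arcs of length 1/N. -/
theorem norm_geomExp_sq_le (N : ℕ) (β : ℝ) :
    ‖geomExp (2 * N) β‖ ^ 2 ≤
      8 * (N : ℝ) ^ 2 * (1 / (1 + (round (N * (β - round β)) : ℝ) ^ 2)) := by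
  have h1 := norm_geomExp_le (2 * N) β
  have h2 := norm_geomExp_mul_abs_le (2 * N) β
  have h3 := abs_sub_round ((N : ℝ) * (β - round β))
  push_cast at h1
  set A := ‖geomExp (2 * N) β‖
  set j : ℝ := (round ((N : ℝ) * (β - round β)) : ℝ)
  set y : ℝ := β - round β
  have hA : 0 ≤ A := norm_nonneg _
  rw [mul_one_div, le_div_iff₀ (by positivity)]
  have hA2 : A ^ 2 ≤ (2 * (N : ℝ)) ^ 2 := pow_le_pow_left₀ hA h1 2
  have hAy : (A * |y|) ^ 2 ≤ (1 / 2) ^ 2 := pow_le_pow_left₀ (by positivity) h2 2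
  rw [mul_pow, sq_abs] at hAy
  have hj : j ^ 2 ≤ 2 * (N * y) ^ 2 + 1 / 2 := by
    have h4 : (N * y - j) ^ 2 ≤ (1 / 2) ^ 2 := by
      rw [← sq_abs]; exact pow_le_pow_left₀ (abs_nonneg _) h3 2
    nlinarith [sq_nonneg (2 * (N * y) - j)]
  have h5 : A ^ 2 * j ^ 2 ≤ A ^ 2 * (2 * (N * y) ^ 2 + 1 / 2) :=
    mul_le_mul_of_nonneg_left hj (sq_nonneg _)
  have h6 : (N : ℝ) ^ 2 * (A ^ 2 * y ^ 2) ≤ (N : ℝ) ^ 2 * (1 / 2) ^ 2 :=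
    mul_le_mul_of_nonneg_left hAy (sq_nonneg _)
  nlinarith

theorem summable_one_div_one_add_int_sq : Summable fun j : ℤ => 1 / (1 + (j : ℝ) ^ 2) := by
  refine Summable.of_norm_bounded_eventually (g := fun j : ℤ => 1 / (j : ℝ) ^ 2)
    (Real.summable_one_div_int_pow.mpr (by norm_num)) ?_
  have : ∀ᶠ j : ℤ in Filter.cofinite, j ≠ 0 := by
    exact (Set.finite_singleton (0 : ℤ)).eventually_cofinite_notMem
  filter_upwards [this] with j hj
  have hj' : (0 : ℝ) < (j : ℝ) ^ 2 := by positivity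
  rw [Real.norm_of_nonneg (by positivity)]
  exact one_div_le_one_div_of_le hj' (by linarith)

-- Points sharing the rounded value j lie within 1/(2N) of α + j/N modulo 1, so there are at most K
-- of them, and the weights 1/(1 + j²) have a finite sum.
open Finset in
open scoped Classical in
theorem sum_norm_geomExp_sq_le {ι : Type*} (s : Finset ι) (x : ι → ℝ) {N : ℕ} (hN : 0 < N) {K : ℝ}
    (hK : ∀ α : ℝ, (#{i ∈ s | ∃ k : ℤ, |x i - α - k| ≤ 1 / N} : ℝ) ≤ K) (α : ℝ) :
    ∑ i ∈ s, ‖geomExp (2 * N) (x i - α)‖ ^ 2 ≤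
      8 * (∑' j : ℤ, 1 / (1 + (j : ℝ) ^ 2)) * K * (N : ℝ) ^ 2 := by
  have hN' : (0 : ℝ) < N := by exact_mod_cast hN
  have hK0 : 0 ≤ K := le_trans (by positivity) (hK 0)
  set J : ι → ℤ := fun i => round ((N : ℝ) * (x i - α - round (x i - α))) with hJ
  calc ∑ i ∈ s, ‖geomExp (2 * N) (x i - α)‖ ^ 2
      ≤ ∑ i ∈ s, 8 * (N : ℝ) ^ 2 * (1 / (1 + (J i : ℝ) ^ 2)) :=
        sum_le_sum fun i _ => norm_geomExp_sq_le N _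
    _ = ∑ j ∈ s.image J, ∑ i ∈ s with J i = j, 8 * (N : ℝ) ^ 2 * (1 / (1 + (J i : ℝ) ^ 2)) :=
        (sum_fiberwise_of_maps_to (fun i hi => mem_image_of_mem J hi) _).symm
    _ = ∑ j ∈ s.image J, (#{i ∈ s | J i = j} : ℝ) * (8 * (N : ℝ) ^ 2 * (1 / (1 + (j : ℝ) ^ 2))) := by
        refine sum_congr rfl fun j _ => ?_
        rw [← nsmul_eq_mul, ← sum_const]
        exact sum_congr rfl fun i hi => by rw [(mem_filter.mp hi).2]
    _ ≤ ∑ j ∈ s.image J, K * (8 * (N : ℝ) ^ 2 * (1 / (1 + (j : ℝ) ^ 2))) := by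
        refine sum_le_sum fun j _ => mul_le_mul_of_nonneg_right ?_ (by positivity)
        refine le_trans ?_ (hK (α + j / N))
        have hsub : {i ∈ s | J i = j} ⊆ {i ∈ s | ∃ k : ℤ, |x i - (α + j / N) - k| ≤ 1 / N} := by
          intro i hi
          obtain ⟨his, hij⟩ := mem_filter.mp hi
          refine mem_filter.mpr ⟨his, round (x i - α), ?_⟩
          have h1 := abs_sub_round ((N : ℝ) * (x i - α - round (x i - α)))
          have h2 : (round ((N : ℝ) * (x i - α - round (x i - α))) : ℝ) = j := by
            exact_mod_cast hij
          rw [h2] at h1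
          have h3 : x i - (α + j / N) - round (x i - α) =
              (N * (x i - α - round (x i - α)) - j) / N := by field_simp; ring
          rw [h3, abs_div, abs_of_pos hN']
          exact div_le_div_of_nonneg_right (h1.trans (by norm_num)) hN'.le
        exact_mod_cast card_le_card hsub
    _ = 8 * (∑ j ∈ s.image J, 1 / (1 + (j : ℝ) ^ 2)) * K * (N : ℝ) ^ 2 := by
        rw [mul_sum, sum_mul, sum_mul]
        exact sum_congr rfl fun _ _ => by ring
    _ ≤ _ := by
        have := summable_one_div_one_add_int_sq.sum_le_tsum (s.image J)
          fun _ _ => by positivity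
        gcongr

/-! ### Duality and the large sieve -/

/-- The dual trigonometric sum `∑_i c_i e(n x_i)`. -/
noncomputable def dualSum {ι : Type*} (s : Finset ι) (x : ι → ℝ) (c : ι → ℂ) (n : ℤ) : ℂ :=
  ∑ i ∈ s, c i * e (n * x i)

-- Each n in the window is M + 1 + h₁ − h₂ for every h₂ < N and a suitable h₁ < 2N. This smoothing
-- replaces the sharp cutoff by a Fejér weight.
open Finset in
theorem mul_sum_le_sum_sub (f : ℤ → ℝ) (hf : ∀ n, 0 ≤ f n) (M : ℤ) (N : ℕ) :
    N * ∑ n ∈ Icc (M + 1) (M + N), f n ≤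
      ∑ h₁ ∈ range (2 * N), ∑ h₂ ∈ range (2 * N), f (M + 1 + h₁ - h₂) := by
  rw [sum_comm]
  calc N * ∑ n ∈ Icc (M + 1) (M + N), f n
      = ∑ h₂ ∈ range N, ∑ n ∈ Icc (M + 1) (M + N), f n := by
        rw [sum_const, card_range, nsmul_eq_mul]
    _ ≤ ∑ h₂ ∈ range N, ∑ h₁ ∈ range (2 * N), f (M + 1 + h₁ - h₂) := by
        refine sum_le_sum fun h₂ hh₂ => ?_
        rw [mem_range] at hh₂
        rw [← sum_image (s := range (2 * N)) (g := fun h₁ : ℕ => M + 1 + h₁ - h₂) (f := f)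
          (fun a _ b _ hab => by simp only at hab; omega)]
        refine sum_le_sum_of_subset_of_nonneg (fun n hn => ?_) fun _ _ _ => hf _
        rw [mem_Icc] at hn
        exact mem_image.mpr ⟨(n - M - 1 + h₂).toNat, by rw [mem_range]; omega, by omega⟩
    _ ≤ _ := sum_le_sum_of_subset_of_nonneg (range_subset_range.mpr (by omega))
        fun _ _ _ => sum_nonneg fun _ _ => hf _

open Finset in
theorem sum_norm_dualSum_sq_eq {ι : Type*} (s : Finset ι) (x : ι → ℝ) (c : ι → ℂ) (m : ℤ) (H : ℕ) :
    ((∑ h₁ ∈ range H, ∑ h₂ ∈ range H, ‖dualSum s x c (m + h₁ - h₂)‖ ^ 2 : ℝ) : ℂ) =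
      ∑ i ∈ s, ∑ j ∈ s, c i * (starRingEnd ℂ) (c j) * e (m * (x i - x j)) *
        (geomExp H (x i - x j) * geomExp H (-(x i - x j))) := by
  have h1 : ∀ n : ℤ, ((‖dualSum s x c n‖ ^ 2 : ℝ) : ℂ) =
      ∑ i ∈ s, ∑ j ∈ s, c i * (starRingEnd ℂ) (c j) * e (n * (x i - x j)) := by
    intro n
    rw [Complex.ofReal_pow, ← Complex.mul_conj', dualSum, map_sum, sum_mul_sum]
    refine sum_congr rfl fun i _ => sum_congr rfl fun j _ => ?_
    rw [map_mul, conj_e, mul_sub, sub_eq_add_neg, e_add]; ring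
  have h2 : ∀ (h₁ h₂ : ℕ) (β : ℝ), e (((m + h₁ - h₂ : ℤ) : ℝ) * β) =
      e (m * β) * (e (h₁ * β) * e (h₂ * -β)) := by
    intro h₁ h₂ β
    rw [← e_add, ← e_add]; congr 1; push_cast; ring
  rw [Complex.ofReal_sum]
  simp only [Complex.ofReal_sum, h1, h2]
  simp only [geomExp, sum_mul, mul_sum]
  calc _ = ∑ h₁ ∈ range H, ∑ i ∈ s, ∑ h₂ ∈ range H, ∑ j ∈ s, _ :=
        sum_congr rfl fun _ _ => sum_comm
    _ = ∑ i ∈ s, ∑ h₁ ∈ range H, ∑ h₂ ∈ range H, ∑ j ∈ s, _ := sum_comm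
    _ = ∑ i ∈ s, ∑ h₁ ∈ range H, ∑ j ∈ s, ∑ h₂ ∈ range H, _ :=
        sum_congr rfl fun _ _ => sum_congr rfl fun _ _ => sum_comm
    _ = ∑ i ∈ s, ∑ j ∈ s, ∑ h₁ ∈ range H, ∑ h₂ ∈ range H, _ :=
        sum_congr rfl fun _ _ => sum_comm
    _ = _ := by
        refine sum_congr rfl fun _ _ => sum_congr rfl fun _ _ => ?_
        rw [sum_comm]
        refine sum_congr rfl fun _ _ => sum_congr rfl fun _ _ => ?_
        ring

-- Schur's test: after |c_i c_j| ≤ (|c_i|² + |c_j|²)/2, symmetry of the kernel makes both halves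
-- equal, and each is governed by a column sum of the kernel.
open Finset in
theorem sum_norm_dualSum_sq_le {ι : Type*} (s : Finset ι) (x : ι → ℝ) (c : ι → ℂ) (M : ℤ) (N : ℕ)
    {D : ℝ} (hD : ∀ α : ℝ, ∑ i ∈ s, ‖geomExp (2 * N) (x i - α)‖ ^ 2 ≤ D) :
    N * ∑ n ∈ Icc (M + 1) (M + N), ‖dualSum s x c n‖ ^ 2 ≤ D * ∑ i ∈ s, ‖c i‖ ^ 2 := by
  refine (mul_sum_le_sum_sub (fun n => ‖dualSum s x c n‖ ^ 2) (fun _ => by positivity) M N).trans ?_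
  set G : ι → ι → ℝ := fun i j => ‖geomExp (2 * N) (x i - x j)‖ ^ 2 with hG
  have hsymm : ∀ i j, G i j = G j i := fun i j => by
    simp only [hG]; rw [← norm_geomExp_neg, neg_sub]
  have h1 := sum_norm_dualSum_sq_eq s x c (M + 1) (2 * N)
  set T : ℝ := ∑ h₁ ∈ range (2 * N), ∑ h₂ ∈ range (2 * N),
    ‖dualSum s x c (M + 1 + h₁ - h₂)‖ ^ 2 with hT
  have hcol : ∑ i ∈ s, ∑ j ∈ s, ‖c j‖ ^ 2 * G i j ≤ D * ∑ i ∈ s, ‖c i‖ ^ 2 := by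
    rw [sum_comm, mul_sum]
    refine sum_le_sum fun j _ => ?_
    rw [← mul_sum, mul_comm D]
    exact mul_le_mul_of_nonneg_left (hD (x j)) (by positivity)
  have hrow : ∑ i ∈ s, ∑ j ∈ s, ‖c i‖ ^ 2 * G i j = ∑ i ∈ s, ∑ j ∈ s, ‖c j‖ ^ 2 * G i j := by
    rw [sum_comm]
    exact sum_congr rfl fun i _ => sum_congr rfl fun j _ => by rw [hsymm]
  have hbound : T ≤ ∑ i ∈ s, ∑ j ∈ s, ‖c i‖ * ‖c j‖ * G i j := by
    calc T ≤ ‖(T : ℂ)‖ := by rw [Complex.norm_real]; exact le_abs_self T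
      _ ≤ _ := by
        rw [h1]
        refine (norm_sum_le _ _).trans (sum_le_sum fun i _ => (norm_sum_le _ _).trans
          (sum_le_sum fun j _ => le_of_eq ?_))
        simp only [norm_mul, Complex.norm_conj, norm_e, norm_geomExp_neg, hG]
        ring
  have hamgm : ∑ i ∈ s, ∑ j ∈ s, ‖c i‖ * ‖c j‖ * G i j ≤
      ∑ i ∈ s, ∑ j ∈ s, (‖c i‖ ^ 2 * G i j + ‖c j‖ ^ 2 * G i j) / 2 := by
    refine sum_le_sum fun i _ => sum_le_sum fun j _ => ?_
    have : 0 ≤ G i j := by positivity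
    nlinarith [mul_nonneg this (sq_nonneg (‖c i‖ - ‖c j‖))]
  simp only [← sum_div, sum_add_distrib] at hamgm
  rw [hrow] at hamgm
  linarith

open Finset in
open scoped Classical in
/-- The large sieve inequality for points with at most `K` of them in any arc of radius `1 / N`. -/
theorem sum_norm_S_sq_le {ι : Type*} (s : Finset ι) (x : ι → ℝ) (a : ℤ → ℂ) (M : ℤ) {N : ℕ}
    (hN : 0 < N) {K : ℝ}
    (hK : ∀ α : ℝ, (#{i ∈ s | ∃ k : ℤ, |x i - α - k| ≤ 1 / N} : ℝ) ≤ K) :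
    ∑ i ∈ s, ‖S M N a (x i)‖ ^ 2 ≤
      8 * (∑' j : ℤ, 1 / (1 + (j : ℝ) ^ 2)) * K * N * Z M N a := by
  have hN' : (0 : ℝ) < N := by exact_mod_cast hN
  -- With this choice W is the pairing of a with the dual sum, so Cauchy–Schwarz gives W² ≤ Z · E N
  -- W, and one factor W cancels.
  set c : ι → ℂ := fun i => (starRingEnd ℂ) (S M N a (x i)) with hc
  set W := ∑ i ∈ s, ‖S M N a (x i)‖ ^ 2 with hW
  set E := 8 * (∑' j : ℤ, 1 / (1 + (j : ℝ) ^ 2)) * K with hE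
  have hW0 : 0 ≤ W := sum_nonneg fun _ _ => by positivity
  have hdual := sum_norm_dualSum_sq_le s x c M N (sum_norm_geomExp_sq_le s x hN hK)
  have hcW : ∑ i ∈ s, ‖c i‖ ^ 2 = W := by simp only [hc, Complex.norm_conj, hW]
  rw [hcW, ← hE] at hdual
  have hdual' : ∑ n ∈ Icc (M + 1) (M + N), ‖dualSum s x c n‖ ^ 2 ≤ E * N * W := by
    refine le_of_mul_le_mul_left (hdual.trans (le_of_eq ?_)) hN'
    ring
  have hEW : (W : ℂ) = ∑ n ∈ Icc (M + 1) (M + N), a n * dualSum s x c n := by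
    simp only [hW, dualSum, mul_sum]
    rw [sum_comm, Complex.ofReal_sum]
    refine sum_congr rfl fun i _ => ?_
    rw [Complex.ofReal_pow, ← Complex.conj_mul']
    conv_lhs => rw [S]
    conv_lhs => rw [mul_comm, sum_mul]
    refine sum_congr rfl fun n _ => ?_
    simp only [hc, S]; ring
  have hWle : W ≤ ∑ n ∈ Icc (M + 1) (M + N), ‖a n‖ * ‖dualSum s x c n‖ := by
    calc W ≤ ‖(W : ℂ)‖ := by rw [Complex.norm_real]; exact le_abs_self W
      _ ≤ _ := by
        rw [hEW]
        exact (norm_sum_le _ _).trans (le_of_eq (sum_congr rfl fun _ _ => norm_mul _ _))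
  have hCS := sum_mul_sq_le_sq_mul_sq (Icc (M + 1) (M + N)) (fun n => ‖a n‖)
    fun n => ‖dualSum s x c n‖
  have hZ0 : 0 ≤ Z M N a := sum_nonneg fun _ _ => by positivity
  have hsq : W ^ 2 ≤ Z M N a * (E * N * W) :=
    (pow_le_pow_left₀ hW0 hWle 2).trans (hCS.trans (mul_le_mul_of_nonneg_left hdual' hZ0))
  rcases hW0.eq_or_lt with h | h
  · rw [← h]
    have hK0 : 0 ≤ K := le_trans (by positivity) (hK 0)
    have : 0 ≤ ∑' j : ℤ, 1 / (1 + (j : ℝ) ^ 2) := tsum_nonneg fun _ => by positivity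
    positivity
  · refine le_of_mul_le_mul_right (le_trans (le_of_eq ?_) (hsq.trans (le_of_eq ?_))) h
    · ring
    · ring

end SquareModuliSieve

/-! ### Counting fractions a/q² in a short arc -/

namespace SquareModuliSieve

/-- Two denominators `q₁ ≤ q₂` sharing the same value of `m = a r - b q²` are close. -/
theorem sub_le_of_abs_sub_le {m ρ z Δ Q q₁ q₂ : ℝ} (hρ : 0 < ρ) (hΔ : 0 < Δ)
    (hq₁ : 0 < q₁) (hq₂ : 0 < q₂) (hq₁Q : q₁ ≤ Q) (hq₂Q : q₂ ≤ Q)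
    (h₁ : |m - ρ * q₁ ^ 2 * z| ≤ ρ * q₁ ^ 2 * Δ) (h₂ : |m - ρ * q₂ ^ 2 * z| ≤ ρ * q₂ ^ 2 * Δ) :
    q₂ - q₁ ≤ 6 * Q * Δ / (|z| + Δ) := by
  have hz : 0 ≤ |z| := abs_nonneg z
  rw [le_div_iff₀ (by positivity)]
  rcases le_total q₂ q₁ with hle | hle
  · have : (q₂ - q₁) * (|z| + Δ) ≤ 0 :=
      mul_nonpos_of_nonpos_of_nonneg (by linarith) (by positivity)
    have : 0 ≤ 6 * Q * Δ := by have : 0 < Q := by linarith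
                               positivity
    linarith
  · have hd : 0 ≤ q₂ - q₁ := by linarith
    -- Subtracting the two hypotheses eliminates m; dividing by q₁ + q₂ then bounds |z|(q₂ − q₁).
    have key : |z| * (q₂ - q₁) * (q₂ + q₁) ≤ (q₁ ^ 2 + q₂ ^ 2) * Δ := by
      have h3 : |ρ * z * (q₂ ^ 2 - q₁ ^ 2)| ≤ ρ * q₁ ^ 2 * Δ + ρ * q₂ ^ 2 * Δ := by
        have := abs_sub (m - ρ * q₁ ^ 2 * z) (m - ρ * q₂ ^ 2 * z)
        have e1 : m - ρ * q₁ ^ 2 * z - (m - ρ * q₂ ^ 2 * z) = ρ * z * (q₂ ^ 2 - q₁ ^ 2) := by ring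
        rw [e1] at this
        linarith
      rw [abs_mul, abs_mul, abs_of_pos hρ,
        abs_of_nonneg (by nlinarith : (0 : ℝ) ≤ q₂ ^ 2 - q₁ ^ 2)] at h3
      refine le_of_mul_le_mul_left ?_ hρ
      linarith
    have h4 : |z| * (q₂ - q₁) * (q₂ + q₁) ≤ (2 * Q * Δ) * (q₂ + q₁) := by
      refine key.trans ?_
      have : q₁ ^ 2 + q₂ ^ 2 ≤ 2 * Q * (q₂ + q₁) := by nlinarith
      nlinarith
    have h5 := le_of_mul_le_mul_right h4 (by linarith)
    nlinarith

open Finset in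
theorem card_fracs_le_card_divisors_sq {N : ℕ} (hN : 0 < N) {Q : ℝ} (hQ : 1 ≤ Q) (α : ℝ)
    (F : Finset (ℤ × ℤ))
    (hF : ∀ p ∈ F, 0 < p.1 ∧ (p.1 : ℝ) ≤ Q ∧ IsCoprime p.2 p.1 ∧
      |(p.2 : ℝ) / (p.1 : ℝ) ^ 2 - α| ≤ 1 / N) :
    ∃ r : ℕ, 0 < r ∧ r ≤ N ∧
      (#F : ℝ) ≤ 24 * (#r.divisors : ℝ) ^ 2 * (1 + Q ^ 3 / N + Q ^ 2 / √N) := by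
  have hN' : (0 : ℝ) < N := by exact_mod_cast hN
  have hsq : 0 < √(N : ℝ) := Real.sqrt_pos.mpr hN'
  have hs : 0 < N.sqrt := Nat.sqrt_pos.mpr hN
  -- The cutoff √N balances the two errors: both r|z| and rΔ are at most 1/√N.
  obtain ⟨ξ, hξ, hden⟩ := Real.exists_rat_abs_sub_le_and_den_le α hs
  set r : ℕ := ξ.den with hr
  set b : ℤ := ξ.num with hb
  set z : ℝ := α - ξ with hz
  set Δ : ℝ := 1 / N with hΔ
  have hΔ0 : 0 < Δ := by positivity
  have hr0 : 0 < r := ξ.den_pos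
  have hr' : (0 : ℝ) < r := by exact_mod_cast hr0
  have hcop : IsCoprime (r : ℤ) b := by
    rw [Int.isCoprime_iff_gcd_eq_one, Int.gcd_comm]
    exact ξ.reduced
  have hα : α = b / r + z := by rw [hz, Rat.cast_def ξ]; ring
  have hrsq : (r : ℝ) ≤ √N := le_trans (by exact_mod_cast hden) Real.nat_sqrt_le_real_sqrt
  have hNsq : √(N : ℝ) * √N = N := Real.mul_self_sqrt hN'.le
  have hrz : r * |z| ≤ 1 / √N := by
    have h1 : r * |z| ≤ 1 / (N.sqrt + 1) := by
      rw [le_div_iff₀ (by positivity)]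
      rw [le_div_iff₀ (by positivity)] at hξ
      linarith
    exact h1.trans (one_div_le_one_div_of_le hsq Real.real_sqrt_lt_nat_sqrt_succ.le)
  have hrΔ : r * Δ ≤ 1 / √N := by
    rw [hΔ, mul_one_div, div_le_div_iff₀ hN' hsq, one_mul]
    exact (mul_le_mul_of_nonneg_right hrsq hsq.le).trans_eq hNsq
  set m : ℤ × ℤ → ℤ := fun p => p.2 * r - b * p.1 ^ 2 with hm
  set τ : ℝ := (#r.divisors : ℝ) with hτ
  have hτ1 : 1 ≤ τ := by
    have : 0 < #r.divisors := card_pos.mpr ⟨1, Nat.one_mem_divisors.mpr hr0.ne'⟩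
    rw [hτ]
    exact_mod_cast this
  have hτ0 : 0 ≤ τ := by linarith
  clear_value τ
  set B : ℝ := r * Q ^ 2 * (|z| + Δ) with hB
  have hB0 : 0 ≤ B := by positivity
  set L : ℝ := 6 * Q * Δ / (|z| + Δ) with hL
  have hL0 : 0 ≤ L := by positivity
  have hLB : L * B = 6 * (r * (Q ^ 3 * Δ)) := by
    rw [hL, hB]
    have : |z| + Δ ≠ 0 := by positivity
    field_simp
  have hBle : B ≤ 2 * (Q ^ 2 / √N) := by
    have : B = Q ^ 2 * (r * |z| + r * Δ) := by rw [hB]; ring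
    rw [this, show 2 * (Q ^ 2 / √(N : ℝ)) = Q ^ 2 * (1 / √N + 1 / √N) by ring]
    gcongr
  have hmz : ∀ p ∈ F, |(m p : ℝ) - r * (p.1 : ℝ) ^ 2 * z| ≤ r * (p.1 : ℝ) ^ 2 * Δ := by
    intro p hp
    obtain ⟨h1, -, -, h4⟩ := hF p hp
    have hp1 : (0 : ℝ) < p.1 := by exact_mod_cast h1
    have : (m p : ℝ) - r * (p.1 : ℝ) ^ 2 * z =
        r * (p.1 : ℝ) ^ 2 * ((p.2 : ℝ) / (p.1 : ℝ) ^ 2 - α) := by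
      rw [hα, hm]; push_cast; field_simp; ring
    rw [this, abs_mul, abs_of_pos (by positivity)]
    gcongr
  have hmB : ∀ p ∈ F, |(m p : ℝ)| ≤ B := by
    intro p hp
    obtain ⟨h1, h2, -, -⟩ := hF p hp
    have hp1 : (0 : ℝ) < p.1 := by exact_mod_cast h1
    have h3 := abs_sub_abs_le_abs_sub (m p : ℝ) (r * (p.1 : ℝ) ^ 2 * z)
    rw [abs_mul, abs_of_pos (show 0 < r * (p.1 : ℝ) ^ 2 by positivity)] at h3
    have h4 := hmz p hp
    calc |(m p : ℝ)| ≤ r * (p.1 : ℝ) ^ 2 * (|z| + Δ) := by linarith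
      _ ≤ B := by rw [hB]; gcongr
  have hinj : ∀ p ∈ F, ∀ p' ∈ F, m p = m p' → p.1 = p'.1 → p = p' := by
    intro p _ p' _ h1 h2
    refine Prod.ext h2 ?_
    simp only [hm, h2] at h1
    have hrz : (r : ℤ) ≠ 0 := by exact_mod_cast hr0.ne'
    exact mul_right_cancel₀ hrz (by linarith)
  have hfib : ∀ k : ℤ, (#{p ∈ F | m p = k} : ℝ) ≤ τ * (1 + 2 * L * (k.gcd r : ℕ) / r) := by
    intro k
    have hinjOn : Set.InjOn Prod.fst (({p ∈ F | m p = k} : Finset (ℤ × ℤ)) : Set (ℤ × ℤ)) := by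
      intro p hp p' hp' h
      rw [mem_coe, mem_filter] at hp hp'
      exact hinj p hp.1 p' hp'.1 (hp.2.trans hp'.2.symm) h
    rw [← card_image_of_injOn hinjOn, hτ]
    refine Int.card_le_of_dvd_mul_sq_add hr0 hL0 hcop (fun q hq => ?_) fun q hq q' hq' => ?_
    · obtain ⟨p, hp, rfl⟩ := mem_image.mp hq
      rw [← (mem_filter.mp hp).2]
      exact ⟨p.2, by simp only [hm]; ring⟩
    · obtain ⟨p, hp, rfl⟩ := mem_image.mp hq
      obtain ⟨p', hp', rfl⟩ := mem_image.mp hq'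
      rw [mem_filter] at hp hp'
      obtain ⟨a1, a2, -, -⟩ := hF p hp.1
      obtain ⟨b1, b2, -, -⟩ := hF p' hp'.1
      have c1 := hmz p hp.1
      have c2 := hmz p' hp'.1
      rw [hp.2] at c1
      rw [hp'.2] at c2
      exact sub_le_of_abs_sub_le hr' hΔ0 (by exact_mod_cast b1) (by exact_mod_cast a1) b2 a2 c2 c1
  -- The fibre bound is too weak here, as gcd(0, r) = r. But m = 0 means a/q² = b/r with both sides
  -- reduced, so q² = r.
  have hzero : #{p ∈ F | m p = 0} ≤ 1 := by
    refine card_le_one.mpr fun p hp p' hp' => ?_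
    rw [mem_filter] at hp hp'
    have hden : ∀ p ∈ F, m p = 0 → p.1 ^ 2 = r := by
      intro p hp h0
      obtain ⟨h1, -, h3, -⟩ := hF p hp
      simp only [hm] at h0
      have d1 : p.1 ^ 2 ∣ (r : ℤ) := by
        have : p.1 ^ 2 ∣ p.2 * r := ⟨b, by linarith⟩
        exact (h3.symm.pow_left).dvd_of_dvd_mul_left this
      have d2 : (r : ℤ) ∣ p.1 ^ 2 := by
        have : (r : ℤ) ∣ b * p.1 ^ 2 := ⟨p.2, by linarith⟩
        exact hcop.dvd_of_dvd_mul_left this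
      exact Int.dvd_antisymm (by positivity) (by positivity) d1 d2
    have e1 := hden p hp.1 hp.2
    have e2 := hden p' hp'.1 hp'.2
    refine hinj p hp.1 p' hp'.1 (hp.2.trans hp'.2.symm) ?_
    exact (pow_left_inj₀ (hF p hp.1).1.le (hF p' hp'.1).1.le two_ne_zero).mp (e1.trans e2.symm)
  have hcard : (#F : ℝ) ≤ 1 + ∑ n ∈ Ioc 0 ⌊B⌋₊, 2 * (τ * (1 + 2 * L * (n.gcd r : ℕ) / r)) := by
    have hmaps : Set.MapsTo (fun p => (m p).natAbs) (F : Set (ℤ × ℤ))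
        (insert 0 (Ioc 0 ⌊B⌋₊) : Finset ℕ) := by
      intro p hp
      have h1 : (m p).natAbs ≤ ⌊B⌋₊ := Nat.le_floor (by
        rw [Nat.cast_natAbs, Int.cast_abs]; exact hmB p hp)
      simp only [mem_coe, mem_insert, mem_Ioc]
      omega
    rw [card_eq_sum_card_fiberwise hmaps, sum_insert (by simp)]
    push_cast
    refine add_le_add ?_ (sum_le_sum fun n _ => ?_)
    · simp only [Int.natAbs_eq_zero]
      exact_mod_cast hzero
    · have h1 : #{p ∈ F | (m p).natAbs = n} ≤ #{p ∈ F | m p = n} + #{p ∈ F | m p = -n} := by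
        refine le_trans (card_le_card fun p hp => ?_) (card_union_le _ _)
        simp only [mem_union, mem_filter] at hp ⊢
        rcases Int.natAbs_eq (m p) with h | h
        · exact Or.inl ⟨hp.1, by rw [← hp.2]; exact h⟩
        · exact Or.inr ⟨hp.1, by rw [← hp.2]; exact h⟩
      have h2 := hfib n
      have h3 := hfib (-n)
      rw [Int.neg_gcd] at h3
      rw [Int.gcd_natCast_natCast] at h2 h3
      have h1' : (#{p ∈ F | (m p).natAbs = n} : ℝ) ≤
        #{p ∈ F | m p = n} + #{p ∈ F | m p = -n} := by exact_mod_cast h1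
      linarith
  -- The 24 is 4 · 6, with 6 coming from `hLB`.
  have hsum : ∑ n ∈ Ioc 0 ⌊B⌋₊, 2 * (τ * (1 + 2 * L * (n.gcd r : ℕ) / r)) ≤
      2 * τ * B + 24 * τ ^ 2 * (Q ^ 3 * Δ) := by
    have hg : ((∑ n ∈ Ioc 0 ⌊B⌋₊, n.gcd r : ℕ) : ℝ) ≤ B * τ := by
      have h1 : ((∑ n ∈ Ioc 0 ⌊B⌋₊, n.gcd r : ℕ) : ℝ) ≤ ⌊B⌋₊ * τ := by
        rw [hτ]
        exact_mod_cast Nat.sum_gcd_le_mul_card_divisors ⌊B⌋₊ hr0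
      exact h1.trans (mul_le_mul_of_nonneg_right (Nat.floor_le hB0) (by linarith))
    have e1 : ∑ n ∈ Ioc 0 ⌊B⌋₊, 2 * (τ * (1 + 2 * L * (n.gcd r : ℕ) / r)) =
        2 * τ * ⌊B⌋₊ + 4 * τ * L / r * ((∑ n ∈ Ioc 0 ⌊B⌋₊, n.gcd r : ℕ) : ℝ) := by
      have : ∀ n : ℕ, 2 * (τ * (1 + 2 * L * (n.gcd r : ℕ) / r)) =
        2 * τ + 4 * τ * L / r * (n.gcd r : ℕ) := fun n => by ring
      simp only [this]
      rw [sum_add_distrib, sum_const, Nat.card_Ioc, nsmul_eq_mul, ← mul_sum]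
      push_cast
      simp only [Nat.sub_zero]; ring
    rw [e1]
    have e2 : 4 * τ * L / r * (B * τ) = 24 * τ ^ 2 * (Q ^ 3 * Δ) := by
      have : 4 * τ * L / r * (B * τ) = 4 * τ ^ 2 * (L * B) / r := by ring
      rw [this, hLB]; field_simp; ring
    rw [← e2]
    refine add_le_add ?_ ?_
    · exact mul_le_mul_of_nonneg_left (Nat.floor_le hB0) (by positivity)
    · exact mul_le_mul_of_nonneg_left hg (by positivity)
  refine ⟨r, hr0, hden.trans (Nat.sqrt_le_self N), ?_⟩
  rw [← hτ]
  have hQ3 : Q ^ 3 * Δ = Q ^ 3 / N := by rw [hΔ]; ring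
  rw [hQ3] at hsum
  have h1 : 2 * τ * B ≤ 24 * τ ^ 2 * (Q ^ 2 / √N) := by
    have : 0 ≤ Q ^ 2 / √(N : ℝ) := by positivity
    have h2 : 2 * τ * B ≤ 2 * τ * (2 * (Q ^ 2 / √N)) :=
      mul_le_mul_of_nonneg_left hBle (by positivity)
    have h3 : τ * (Q ^ 2 / √(N : ℝ)) ≤ τ ^ 2 * (Q ^ 2 / √N) :=
      mul_le_mul_of_nonneg_right (by nlinarith) this
    have h4 : 0 ≤ τ ^ 2 * (Q ^ 2 / √(N : ℝ)) := by positivity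
    linarith
  have h2 : 1 ≤ 24 * τ ^ 2 := by nlinarith
  linarith

/-- The modulus r varies with α, but r ≤ N makes the divisor bound uniform. The exponent ε/2 is used
because τ(r) enters squared. -/
theorem exists_card_fracs_le {ε : ℝ} (hε : 0 < ε) :
    ∃ C : ℝ, 0 < C ∧ ∀ (N : ℕ) (Q α : ℝ) (F : Finset (ℤ × ℤ)), 0 < N → 1 ≤ Q →
      (∀ p ∈ F, 0 < p.1 ∧ (p.1 : ℝ) ≤ Q ∧ IsCoprime p.2 p.1 ∧
        |(p.2 : ℝ) / (p.1 : ℝ) ^ 2 - α| ≤ 1 / N) →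
      (F.card : ℝ) ≤ C * (N : ℝ) ^ ε * (1 + Q ^ 3 / N + Q ^ 2 / √N) := by
  obtain ⟨C, hC1, hC⟩ := Nat.exists_card_divisors_le_mul_rpow (half_pos hε)
  refine ⟨24 * C ^ 2, by positivity, fun N Q α F hN hQ hF => ?_⟩
  obtain ⟨r, hr0, hrN, hr⟩ := card_fracs_le_card_divisors_sq hN hQ α F hF
  refine hr.trans (mul_le_mul_of_nonneg_right ?_ (by positivity))
  have h1 : (r.divisors.card : ℝ) ≤ C * (N : ℝ) ^ (ε / 2) :=
    (hC r hr0.ne').trans (by gcongr)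
  have h2 : ((N : ℝ) ^ (ε / 2)) ^ 2 = (N : ℝ) ^ ε := by
    rw [← Real.rpow_natCast, ← Real.rpow_mul (by positivity)]; norm_num
  calc 24 * (r.divisors.card : ℝ) ^ 2 ≤ 24 * (C * (N : ℝ) ^ (ε / 2)) ^ 2 := by gcongr
    _ = _ := by rw [mul_pow, h2]; ring

-- Passes from the circle to the line: replacing b by b − k q² keeps it coprime to q, and is
-- injective because 1 ≤ b ≤ q².
open Finset in
open scoped Classical in
theorem exists_card_square_fracs_near_le {ε : ℝ} (hε : 0 < ε) :
    ∃ C : ℝ, 0 < C ∧ ∀ (N : ℕ) (Q α : ℝ), 0 < N → 1 ≤ Q →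
      (#{p ∈ (Icc 1 ⌊Q⌋₊).sigma fun q => {b ∈ Icc 1 (q ^ 2) | Nat.Coprime b q} |
        ∃ k : ℤ, |(p.2 : ℝ) / (p.1 : ℝ) ^ 2 - α - k| ≤ 1 / N} : ℝ) ≤
      C * (N : ℝ) ^ ε * (1 + Q ^ 3 / N + Q ^ 2 / √N) := by
  obtain ⟨C, hC0, hC⟩ := exists_card_fracs_le hε
  refine ⟨C, hC0, fun N Q α hN hQ => ?_⟩
  set G := {p ∈ (Icc 1 ⌊Q⌋₊).sigma fun q => {b ∈ Icc 1 (q ^ 2) | Nat.Coprime b q} |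
        ∃ k : ℤ, |(p.2 : ℝ) / (p.1 : ℝ) ^ 2 - α - k| ≤ 1 / N} with hG
  have hmem : ∀ p ∈ G, (1 ≤ p.1 ∧ p.1 ≤ ⌊Q⌋₊) ∧ (1 ≤ p.2 ∧ p.2 ≤ p.1 ^ 2) ∧ p.2.Coprime p.1 ∧
      ∃ k : ℤ, |(p.2 : ℝ) / (p.1 : ℝ) ^ 2 - α - k| ≤ 1 / N := by
    intro p hp
    simp only [hG, mem_filter, mem_sigma, mem_Icc] at hp
    tauto
  choose! k hk using fun p hp => (hmem p hp).2.2.2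
  set φ : (Σ _ : ℕ, ℕ) → ℤ × ℤ := fun p => (p.1, p.2 - k p * p.1 ^ 2) with hφ
  have hinj : Set.InjOn φ G := by
    rintro ⟨q, b⟩ hp ⟨q', b'⟩ hp' h
    obtain ⟨⟨h1, -⟩, ⟨h2, h3⟩, -, -⟩ := hmem _ hp
    obtain ⟨-, ⟨h4, h5⟩, -, -⟩ := hmem _ hp'
    simp only [hφ, Prod.mk.injEq, Nat.cast_inj] at h
    obtain ⟨rfl, h⟩ := h
    simp only at h1 h2 h3 h4 h5
    have hd : ((q : ℤ) ^ 2) ∣ (b : ℤ) - b' := ⟨k ⟨q, b⟩ - k ⟨q, b'⟩, by linarith⟩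
    have h0 : (b : ℤ) - b' = 0 := by
      refine Int.eq_zero_of_abs_lt_dvd hd ?_
      rw [abs_lt]
      zify at h2 h3 h4 h5
      constructor <;> linarith
    have : b = b' := by omega
    rw [this]
  rw [← card_image_of_injOn hinj]
  refine hC N Q α _ hN hQ fun x hx => ?_
  obtain ⟨p, hp, rfl⟩ := mem_image.mp hx
  obtain ⟨⟨h1, h2⟩, -, h3, -⟩ := hmem p hp
  have h4 := hk p hp
  have hp1 : (0 : ℝ) < p.1 := by exact_mod_cast h1
  refine ⟨by simp only [hφ]; omega, ?_, ?_, ?_⟩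
  · simp only [hφ, Int.cast_natCast]
    exact (Nat.le_floor_iff (by linarith)).mp h2
  · have h5 : IsCoprime (p.2 : ℤ) (p.1 : ℤ) := Nat.isCoprime_iff_coprime.mpr h3
    have h6 := h5.add_mul_left_left (-(k p * p.1))
    simp only [hφ]
    rwa [show (p.2 : ℤ) - k p * (p.1 : ℤ) ^ 2 = p.2 + p.1 * -(k p * p.1) by ring]
  · simp only [hφ]
    push_cast
    have : ((p.2 : ℝ) - k p * (p.1 : ℝ) ^ 2) / (p.1 : ℝ) ^ 2 - α =
        (p.2 : ℝ) / (p.1 : ℝ) ^ 2 - α - k p := by field_simp; ring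
    rw [this]
    exact h4

end SquareModuliSieve

/-! ### Conclusion -/

theorem mainTheorem1 :
    ∀ ε : ℝ, 0 < ε → ∃ C : ℝ, 0 < C ∧
      ∀ (M : ℤ) (N : ℕ) (Q : ℝ) (a : ℤ → ℂ), 1 ≤ Q →
        ∑ q ∈ Finset.Icc 1 ⌊Q⌋₊,
          ∑ b ∈ (Finset.Icc 1 (q ^ 2)).filter (fun b : ℕ => Nat.Coprime b q),
            ‖SquareModuliSieve.S M N a ((b : ℝ) / (q : ℝ) ^ 2)‖ ^ 2
        ≤ C * (((N : ℝ) * Q) ^ ε * (Q ^ 3 + (N : ℝ) + Real.sqrt (N : ℝ) * Q ^ 2)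
            * SquareModuliSieve.Z M N a) := by
  intro ε hε
  obtain ⟨C, hC0, hC⟩ := SquareModuliSieve.exists_card_square_fracs_near_le hε
  set T : ℝ := ∑' j : ℤ, 1 / (1 + (j : ℝ) ^ 2) with hT
  have hT0 : 0 < T := SquareModuliSieve.summable_one_div_one_add_int_sq.tsum_pos
    (fun _ => by positivity) 0 (by norm_num)
  refine ⟨8 * T * C, by positivity, fun M N Q a hQ => ?_⟩
  have hQ0 : 0 < Q := by linarith
  rcases N.eq_zero_or_pos with rfl | hN
  · simp [SquareModuliSieve.S, SquareModuliSieve.Z]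
  have hN' : (0 : ℝ) < N := by exact_mod_cast hN
  have hZ0 : 0 ≤ SquareModuliSieve.Z M N a := Finset.sum_nonneg fun _ _ => by positivity
  rw [Finset.sum_sigma']
  refine (SquareModuliSieve.sum_norm_S_sq_le _ (fun p : Σ _ : ℕ, ℕ => (p.2 : ℝ) / (p.1 : ℝ) ^ 2) a M
    hN fun α => hC N Q α hN hQ).trans ?_
  have hsq : 0 < √(N : ℝ) := Real.sqrt_pos.mpr hN'
  have h1 : (N : ℝ) * (Q ^ 2 / √N) = √N * Q ^ 2 := by
    conv_lhs => rw [← Real.mul_self_sqrt hN'.le]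
    rw [Real.sqrt_mul_self hsq.le]
    field_simp
  have h2 : (1 + Q ^ 3 / N + Q ^ 2 / √N) * N = Q ^ 3 + N + √N * Q ^ 2 := by
    rw [← h1]; field_simp; ring
  have h3 : (N : ℝ) ^ ε ≤ ((N : ℝ) * Q) ^ ε :=
    Real.rpow_le_rpow hN'.le (le_mul_of_one_le_right hN'.le hQ) hε.le
  calc 8 * T * (C * (N : ℝ) ^ ε * (1 + Q ^ 3 / N + Q ^ 2 / √N)) * N * SquareModuliSieve.Z M N a
      = 8 * T * C * ((N : ℝ) ^ ε * ((1 + Q ^ 3 / N + Q ^ 2 / √N) * N) *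
          SquareModuliSieve.Z M N a) := by ring
    _ ≤ _ := by rw [h2]; gcongr
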